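/- Let $X\subset\mathbb{R}^2$ be a connected polygon, possibly with holes: $X$ is compact and connected, it is the closure of its interior, and its topological boundary is a union of finitely many closed polygonal chains whose edges have positive length, any two distinct edges meeting at most in common endpoints. Let $\mathcal{V}$ be the finite set of its vertices (the vertices of these chains). A point robot moves in $X$ at unit speed by $$\dot q_x(t)=\sin\theta(t),\qquad \dot q_y(t)=\cos\theta(t).$$ For $x_I, x_G\in X$, a control is a measurable $\theta:[0,T]\to S^1$ with $T\ge 0$ free, and it is admissible if the resulting path satisfies $x(0)=x_I$, $x(T)=x_G$ and $x(t)\in X$ for all $t\in[0,T]$. It is optimal if its $T$, which is the length of the path, is minimal among all admissible controls. An action consists of a direction $\bar\theta\in S^1$ and a target vertex $v\in\mathcal{V}$. Applying it at a point $x \in X$ means keeping the constant control $\bar\theta$ for a positive finite time, with the motion remaining in $X$, until $v$ is reached, $v$ being the first point of $\mathcal{V}$ met after leaving $x$. Let $U$ be the set of actions. **Lemma.** For all $x_I\in X$ and $x_G\in\mathcal{V}$, an optimal control from $x_I$ to $x_G$ exists, and every optimal control $\theta^*$ is obtained (up to equality for almost every $t$) by applying one after the other a finite sequence of actions $(u_1,\dots,u_N)\in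 U^N$, for some $N\ge 0$ (where $N=0$ if $x_I=x_G$). -/

import Mathlib

open Set MeasureTheory

noncomputable section

namespace PolyNav

/-- The Euclidean plane `ℝ²`. -/
abbrev Plane : Type := EuclideanSpace ℝ (Fin 2)

/-- A polygon, possibly with holes: a compact subset of the plane which is the closure of its
interior and whose topological boundary is the union of finitely many closed polygonal chains,
with edges of positive length, two distinct edges meeting at most in common endpoints.
(Vertices with a straight angle are allowed, and so are vertices at which more than two edges
meet.) -/
structure PolygonalRegion where
  /-- the polygon as a set of points -/
  carrier : Set Plane
  /-- the number of boundary chains -/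
  numChains : ℕ
  /-- the number of vertices of each boundary chain -/
  size : Fin numChains → ℕ
  /-- the boundary chains -/
  chain : (i : Fin numChains) → Polygon Plane (size i)
  isCompact : IsCompact carrier
  closure_interior : closure (interior carrier) = carrier
  frontier_eq : frontier carrier = ⋃ i, (chain i).boundary ℝ
  nondegenerate : ∀ i, (chain i).HasNondegenerateEdges
  edges_inter : ∀ e f : (Σ i, Fin (size i)), e ≠ f →
    (chain e.1).edgeSet ℝ e.2 ∩ (chain f.1).edgeSet ℝ f.2 ⊆
      {chain e.1 e.2, chain e.1 (finRotate _ e.2)} ∩ {chain f.1 f.2, chain f.1 (finRotate _ f.2)}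

/-- The set of vertices of a polygon. -/
def PolygonalRegion.vertices (P : PolygonalRegion) : Set Plane :=
  ⋃ i, range (P.chain i).vertices

/-- The unit velocity vector `(sin θ, cos θ)` produced by the control value `θ`. -/
def velocity (θ : Real.Angle) : Plane := !₂[θ.sin, θ.cos]

/-- The state at time `t` of the system `q̇_x = sin θ(t)`, `q̇_y = cos θ(t)`, started at `x₀`. -/
def state (x₀ : Plane) (θ : ℝ → Real.Angle) (t : ℝ) : Plane :=
  x₀ + ∫ s in (0 : ℝ)..t, velocity (θ s)

/-- The control `θ` on `[0, T]` is measurable and steers the robot from `xI` to `xG` inside the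
polygon, in time `T`. -/
structure IsAdmissible (P : PolygonalRegion) (xI xG : Plane) (T : ℝ) (θ : ℝ → Real.Angle) :
    Prop where
  nonneg : 0 ≤ T
  measurable : AEStronglyMeasurable θ (volume.restrict (Icc 0 T))
  state_mem : ∀ t ∈ Icc 0 T, state xI θ t ∈ P.carrier
  final : state xI θ T = xG

/-- The control `θ` on `[0, T]` minimises the travel time (which is the path length) among all
admissible controls with free final time. -/
def IsOptimal (P : PolygonalRegion) (xI xG : Plane) (T : ℝ) (θ : ℝ → Real.Angle) : Prop :=
  IsAdmissible P xI xG T θ ∧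
    ∀ (T' : ℝ) (θ' : ℝ → Real.Angle), IsAdmissible P xI xG T' θ' → T ≤ T'

/-- An action: a constant direction, to be applied until the vertex `target` is reached. -/
structure Action (P : PolygonalRegion) where
  direction : Real.Angle
  target : Plane
  target_mem : target ∈ P.vertices

/-- Applied at the point `x`, the action `u` moves the robot inside the polygon for the positive
time `τ`, at the end of which it reaches the target vertex, the first vertex met after `x`. -/
structure Action.Executes {P : PolygonalRegion} (u : Action P) (x : Plane) (τ : ℝ) : Prop where
  pos : 0 < τ
  reaches : x + τ • velocity u.direction = u.target
  mem : ∀ s ∈ Icc 0 τ, x + s • velocity u.direction ∈ P.carrier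
  first : ∀ s ∈ Ioo 0 τ, x + s • velocity u.direction ∉ P.vertices

/-- The control `θ` on `[0, T]`, started at `xI`, is obtained by applying the actions
`u 0, …, u (N - 1)` one after the other, with switching times `t 0 < t 1 < ⋯ < t N`. Controls
are identified when they agree almost everywhere. -/
def IsObtainedBy {P : PolygonalRegion} (xI : Plane) (T : ℝ) (θ : ℝ → Real.Angle) {N : ℕ}
    (u : Fin N → Action P) : Prop :=
  ∃ t : Fin (N + 1) → ℝ, t 0 = 0 ∧ t (Fin.last N) = T ∧
    ∀ i : Fin N,
      (u i).Executes (state xI θ (t i.castSucc)) (t i.succ - t i.castSucc) ∧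
      ∀ᵐ s ∂(volume.restrict (Icc (t i.castSucc) (t i.succ))), θ s = (u i).direction

end PolyNav

end

namespace PolyNav

open Filter Topology

/-! Controls are traded for 1-Lipschitz paths, for which minimal travel times are attained by
compactness (`exists_isMinimizer`). Some path exists because the polygon is connected and locally
star-shaped (`IsIsolating.segment_subset`).

Near a non-vertex the polygon is convex (`IsIsolating.convex_inter`), so a minimizer cannot be
slower than the chord there. It therefore moves straight at unit speed between vertices. It is also
injective, hence meets the finitely many vertices finitely often and is a finite chain of such
segments.

Back to controls: the derivative of a minimizer gives an admissible control
(`IsMinimizer.isAdmissible`), and a control whose path is a unit-speed segment is a.e. constant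
(`ae_eq_of_state_eq`). -/

lemma subset_of_isPreconnected_of_disjoint_frontier {α : Type*} [TopologicalSpace α] {s X : Set α}
    (hs : IsPreconnected s) (hX : IsClosed X) (hd : Disjoint s (frontier X))
    (hne : (s ∩ X).Nonempty) : s ⊆ X := by
  have hint : ∀ x ∈ s, x ∈ X → x ∈ interior X := fun x hx hxX => by
    by_contra h
    exact hd.le_bot ⟨hx, by rw [hX.frontier_eq]; exact ⟨hxX, h⟩⟩
  refine (hs.subset_left_of_subset_union isOpen_interior hX.isOpen_compl
    (disjoint_compl_right.mono_left interior_subset) (fun x hx => ?_) ?_).trans interior_subset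
  · by_cases h : x ∈ X
    · exact Or.inl (hint x hx h)
    · exact Or.inr h
  · obtain ⟨x, hx, hxX⟩ := hne
    exact ⟨x, hx, hint x hx hxX⟩

/-! ### Local geometry of a polygonal region. -/

/-- The index type of the boundary edges of a polygonal region. -/
abbrev PolygonalRegion.EdgeIndex (P : PolygonalRegion) : Type := Σ i, Fin (P.size i)

/-- A boundary edge of a polygonal region. -/
abbrev PolygonalRegion.edge (P : PolygonalRegion) (e : P.EdgeIndex) : Set Plane :=
  (P.chain e.1).edgeSet ℝ e.2

/-- The first endpoint of an edge. -/
abbrev PolygonalRegion.src (P : PolygonalRegion) (e : P.EdgeIndex) : Plane :=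
  P.chain e.1 e.2

/-- The second endpoint of an edge. -/
abbrev PolygonalRegion.tgt (P : PolygonalRegion) (e : P.EdgeIndex) : Plane :=
  P.chain e.1 (finRotate _ e.2)

namespace PolygonalRegion

variable (P : PolygonalRegion)

lemma isClosed : IsClosed P.carrier := P.isCompact.isClosed

lemma edge_eq (e : P.EdgeIndex) :
    P.edge e = AffineMap.lineMap (P.src e) (P.tgt e) '' Icc (0 : ℝ) 1 := rfl

lemma edge_eq_segment (e : P.EdgeIndex) : P.edge e = segment ℝ (P.src e) (P.tgt e) :=
  affineSegment_eq_segment ℝ _ _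

lemma frontier_eq_iUnion_edge : frontier P.carrier = ⋃ e, P.edge e := by
  rw [P.frontier_eq, iUnion_sigma]
  rfl

lemma edge_subset_carrier (e : P.EdgeIndex) : P.edge e ⊆ P.carrier :=
  ((subset_iUnion P.edge e).trans P.frontier_eq_iUnion_edge.ge).trans P.isClosed.frontier_subset

lemma isClosed_edge (e : P.EdgeIndex) : IsClosed (P.edge e) := by
  rw [edge_eq]
  exact (isCompact_Icc.image AffineMap.lineMap_continuous).isClosed

lemma convex_edge (e : P.EdgeIndex) : Convex ℝ (P.edge e) := by
  rw [edge_eq_segment]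
  exact convex_segment _ _

lemma src_mem_vertices (e : P.EdgeIndex) : P.src e ∈ P.vertices :=
  mem_iUnion.2 ⟨e.1, mem_range_self _⟩

lemma tgt_mem_vertices (e : P.EdgeIndex) : P.tgt e ∈ P.vertices :=
  mem_iUnion.2 ⟨e.1, mem_range_self _⟩

lemma finite_vertices : P.vertices.Finite := finite_iUnion fun _ => finite_range _

lemma vertices_subset_carrier : P.vertices ⊆ P.carrier := by
  intro v hv
  obtain ⟨i, j, rfl⟩ := mem_iUnion.1 hv
  refine P.edge_subset_carrier ⟨i, j⟩ ?_
  rw [edge_eq_segment]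
  exact left_mem_segment ℝ _ _

/-- A radius around `x` is isolating if the ball meets only the edges through `x` and contains no
vertex other than possibly `x`. -/
structure IsIsolating (x : Plane) (r : ℝ) : Prop where
  pos : 0 < r
  mem_edge : ∀ e, ∀ y ∈ P.edge e, y ∈ Metric.ball x r → x ∈ P.edge e
  eq_of_mem : ∀ v ∈ P.vertices, v ∈ Metric.ball x r → v = x

lemma exists_isIsolating (x : Plane) : ∃ r, P.IsIsolating x r := by
  have hA : IsClosed ((⋃ e ∈ {e | x ∉ P.edge e}, P.edge e) ∪ (P.vertices \ {x})) :=
    ((toFinite _).isClosed_biUnion fun e _ => P.isClosed_edge e).union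
      (P.finite_vertices.subset sdiff_subset).isClosed
  have hx : x ∈ ((⋃ e ∈ {e | x ∉ P.edge e}, P.edge e) ∪ (P.vertices \ {x}))ᶜ := by
    simp only [mem_compl_iff, mem_union, mem_iUnion, not_or, not_exists]
    exact ⟨fun e he h => he h, fun h => h.2 rfl⟩
  obtain ⟨r, hr, hsub⟩ := Metric.isOpen_iff.1 hA.isOpen_compl x hx
  refine ⟨r, hr, fun e y hy hyb => ?_, fun v hv hvb => ?_⟩
  · by_contra h
    exact hsub hyb (Or.inl (mem_biUnion (show e ∈ {e | x ∉ P.edge e} from h) hy))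
  · by_contra h
    exact hsub hvb (Or.inr ⟨hv, h⟩)

variable {P} {x : Plane} {r : ℝ}

/-- If the point overshot an end of the edge, that endpoint would be closer to `x` than the point
is, hence a vertex in the ball, hence `x` itself. `h0` and `h1` exclude this case. -/
lemma IsIsolating.lineMap_mem_edge (h : P.IsIsolating x r) {e : P.EdgeIndex} {μ l : ℝ}
    (hμ : μ ∈ Icc (0 : ℝ) 1) (hx : AffineMap.lineMap (P.src e) (P.tgt e) μ = x)
    (h0 : l < 0 → μ ≠ 0) (h1 : 1 < l → μ ≠ 1)
    (hl : AffineMap.lineMap (P.src e) (P.tgt e) l ∈ Metric.ball x r) :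
    AffineMap.lineMap (P.src e) (P.tgt e) l ∈ P.edge e := by
  have hne : P.src e ≠ P.tgt e := P.nondegenerate e.1 e.2
  have hd : 0 < dist (P.src e) (P.tgt e) := dist_pos.2 hne
  rw [edge_eq]
  refine mem_image_of_mem _ ⟨?_, ?_⟩
  · by_contra! hl0
    have hμ0 := lt_of_le_of_ne hμ.1 (h0 hl0).symm
    have hs : P.src e = x := by
      refine h.eq_of_mem _ (P.src_mem_vertices e) ?_
      rw [Metric.mem_ball, ← hx, dist_lineMap_lineMap] at hl
      rw [Metric.mem_ball, ← hx, dist_left_lineMap]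
      refine lt_of_le_of_lt ?_ hl
      gcongr
      rw [Real.norm_of_nonneg hμ.1, Real.dist_eq, abs_sub_comm, abs_of_nonneg] <;> linarith
    rw [← hs, AffineMap.lineMap_eq_left_iff] at hx
    exact hx.elim hne hμ0.ne'
  · by_contra! hl1
    have hμ1 := lt_of_le_of_ne hμ.2 (h1 hl1)
    have hs : P.tgt e = x := by
      refine h.eq_of_mem _ (P.tgt_mem_vertices e) ?_
      rw [Metric.mem_ball, ← hx, dist_lineMap_lineMap] at hl
      rw [Metric.mem_ball, ← hx, dist_right_lineMap]
      refine lt_of_le_of_lt ?_ hl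
      gcongr
      rw [Real.norm_of_nonneg (by linarith), Real.dist_eq, abs_of_nonneg] <;> linarith
    rw [← hs, AffineMap.lineMap_eq_right_iff] at hx
    exact hx.elim hne hμ1.ne

/-- Near each of its points, a polygonal region is star-shaped. -/
lemma IsIsolating.segment_subset (h : P.IsIsolating x r) (hx : x ∈ P.carrier) {y : Plane}
    (hy : y ∈ P.carrier) (hyb : y ∈ Metric.ball x r) : segment ℝ x y ⊆ P.carrier := by
  by_cases hxy : ∃ e, x ∈ P.edge e ∧ y ∈ P.edge e
  · obtain ⟨e, hxe, hye⟩ := hxy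
    exact ((P.convex_edge e).segment_subset hxe hye).trans (P.edge_subset_carrier e)
  -- `x` is left out since it may be a frontier point. Any other frontier point on the segment lies
  -- on an edge through `x`, and that edge would reach `y`, contrary to `hxy`.
  have hsub : AffineMap.lineMap x y '' Ioc (0 : ℝ) 1 ⊆ P.carrier := by
    refine subset_of_isPreconnected_of_disjoint_frontier
      (isPreconnected_Ioc.image _ AffineMap.lineMap_continuous.continuousOn) P.isClosed ?_
      ⟨y, ⟨1, by simp, by simp⟩, hy⟩
    rw [disjoint_left]
    rintro _ ⟨s, hs, rfl⟩ hz
    rw [P.frontier_eq_iUnion_edge] at hz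
    obtain ⟨e, hze⟩ := mem_iUnion.1 hz
    have hzb : AffineMap.lineMap x y s ∈ Metric.ball x r :=
      (convex_ball x r).lineMap_mem (Metric.mem_ball_self h.pos) hyb ⟨hs.1.le, hs.2⟩
    have hxe := h.mem_edge e _ hze hzb
    have hxe' := hxe
    rw [edge_eq] at hze hxe'
    obtain ⟨l, hl, hlz⟩ := hze
    obtain ⟨μ, hμ, hμx⟩ := hxe'
    -- On the line of `e`, `x` has parameter `μ` and the point at fraction `s` of the way to `y` has
    -- parameter `l`.
    have hy_eq : AffineMap.lineMap (P.src e) (P.tgt e) (μ + (l - μ) / s) = y := by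
      have hs0 := hs.1.ne'
      simp only [AffineMap.lineMap_apply_module'] at hlz hμx ⊢
      have h2 : s • (y - x) = (l - μ) • (P.tgt e - P.src e) := by
        linear_combination (norm := module) hμx - hlz
      have h3 : y - x = ((l - μ) / s) • (P.tgt e - P.src e) := by
        rw [div_eq_inv_mul, mul_smul, ← h2, smul_smul, inv_mul_cancel₀ hs0, one_smul]
      rw [add_smul, ← h3]
      linear_combination (norm := module) hμx
    refine hxy ⟨e, hxe, hy_eq ▸ h.lineMap_mem_edge hμ hμx ?_ ?_ (hy_eq.symm ▸ hyb)⟩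
    · rintro h0 rfl
      have := div_nonneg (a := l - 0) (by linarith [hl.1]) hs.1.le
      linarith
    · rintro h0 rfl
      have := div_nonneg (a := 1 - l) (by linarith [hl.2]) hs.1.le
      rw [← neg_sub, neg_div] at h0
      linarith
  rw [segment_eq_image_lineMap]
  rintro _ ⟨s, hs, rfl⟩
  rcases hs.1.eq_or_lt with rfl | hs0
  · simpa using hx
  · exact hsub ⟨s, ⟨hs0, hs.2⟩, rfl⟩

/-- A linear functional vanishing exactly on the line spanned by `w`. -/
lemma exists_linear_eq_zero_iff (w : Plane) (hw : w ≠ 0) :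
    ∃ φ : Plane →ₗ[ℝ] ℝ, ∀ p, φ p = 0 ↔ ∃ l : ℝ, p = l • w := by
  refine ⟨w 0 • (EuclideanSpace.proj 1 : Plane →L[ℝ] ℝ).toLinearMap -
    w 1 • (EuclideanSpace.proj 0 : Plane →L[ℝ] ℝ).toLinearMap, fun p => ?_⟩
  change w 0 * p 1 - w 1 * p 0 = 0 ↔ _
  constructor
  · intro hp
    by_cases h0 : w 0 = 0
    · have h1 : w 1 ≠ 0 := fun h1 => hw (by ext i; fin_cases i <;> simp [h0, h1])
      have hp0 : p 0 = 0 := by simpa [h0, h1] using hp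
      refine ⟨p 1 / w 1, ?_⟩
      ext i
      fin_cases i <;> simp [h0, h1, hp0]
    · refine ⟨p 0 / w 0, ?_⟩
      ext i
      fin_cases i
      · simp [h0]
      · simp only [Fin.mk_one, PiLp.smul_apply, smul_eq_mul]
        field_simp
        linarith
  · rintro ⟨l, rfl⟩
    simp
    ring

/-- Near a point which is not a vertex, a polygonal region is convex. -/
lemma IsIsolating.convex_inter (h : P.IsIsolating x r) (hx : x ∉ P.vertices) :
    Convex ℝ (P.carrier ∩ Metric.ball x r) := by
  by_cases hne : ∃ e, x ∈ P.edge e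
  · obtain ⟨e, hxe⟩ := hne
    -- Two edges meet only at vertices, so `e` is the only edge through `x`.
    have hfr : ∀ z ∈ Metric.ball x r, z ∈ frontier P.carrier → z ∈ P.edge e := by
      intro z hz hzf
      rw [P.frontier_eq_iUnion_edge] at hzf
      obtain ⟨f, hzf⟩ := mem_iUnion.1 hzf
      by_cases hef : e = f
      · exact hef ▸ hzf
      · have := (P.edges_inter e f hef ⟨hxe, h.mem_edge f z hzf hz⟩).1
        rcases this with rfl | rfl
        · exact absurd (P.src_mem_vertices e) hx
        · exact absurd (P.tgt_mem_vertices e) hx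
    obtain ⟨φ, hφ⟩ := exists_linear_eq_zero_iff (P.tgt e - P.src e)
      (sub_ne_zero.2 (P.nondegenerate e.1 e.2).symm)
    have hxe' := hxe
    rw [edge_eq] at hxe'
    obtain ⟨μ, hμ, hμx⟩ := hxe'
    have hzero : ∀ z ∈ Metric.ball x r, φ (z - P.src e) = 0 → z ∈ P.edge e := by
      intro z hz hz0
      obtain ⟨l, hl⟩ := (hφ _).1 hz0
      have hzl : AffineMap.lineMap (P.src e) (P.tgt e) l = z := by
        rw [AffineMap.lineMap_apply_module', ← hl, sub_add_cancel]
      rw [← hzl] at hz ⊢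
      refine h.lineMap_mem_edge hμ hμx ?_ ?_ hz
      · rintro - rfl
        exact hx (by rw [← hμx, AffineMap.lineMap_apply_zero]; exact P.src_mem_vertices e)
      · rintro - rfl
        exact hx (by rw [← hμx, AffineMap.lineMap_apply_one]; exact P.tgt_mem_vertices e)
    have hedge : ∀ z ∈ P.edge e, φ (z - P.src e) = 0 := by
      rintro _ ⟨l, -, rfl⟩
      exact (hφ _).2 ⟨l, by rw [AffineMap.lineMap_apply_module', add_sub_cancel_right]⟩
    -- Applied to `φ` and `-φ`: each open half-disc beside `e` misses the frontier, so it lies in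
    -- the polygon as soon as one of its points does.
    have key : ∀ ψ : Plane →ₗ[ℝ] ℝ, (∀ p, ψ p ≠ 0 → φ p ≠ 0) →
        ∀ y ∈ P.carrier ∩ Metric.ball x r, 0 < ψ (y - P.src e) →
        ∀ z ∈ Metric.ball x r, 0 < ψ (z - P.src e) → z ∈ P.carrier := by
      intro ψ hψ y hy hy0 z hz hz0
      have hconv : Convex ℝ ({z | ψ (P.src e) < ψ z} ∩ Metric.ball x r) :=
        (convex_halfSpace_gt ψ.isLinear _).inter (convex_ball x r)
      rw [map_sub, sub_pos] at hy0 hz0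
      refine subset_of_isPreconnected_of_disjoint_frontier hconv.isPreconnected P.isClosed ?_
        ⟨y, ⟨hy0, hy.2⟩, hy.1⟩ ⟨hz0, hz⟩
      rw [disjoint_left]
      intro w hw hwf
      refine hψ (w - P.src e) ?_ (hedge w (hfr w hw.2 hwf))
      rw [map_sub]
      exact (sub_pos.2 hw.1).ne'
    have hpos := key φ fun _ => id
    have hneg := key (-φ) fun _ => by simp
    simp only [LinearMap.neg_apply, neg_pos] at hneg
    intro y hy z hz a b ha hb hab
    have hb' := convex_ball x r hy.2 hz.2 ha hb hab
    refine ⟨?_, hb'⟩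
    have hcomb : φ (a • y + b • z - P.src e) = a * φ (y - P.src e) + b * φ (z - P.src e) := by
      have : a • y + b • z - P.src e = a • (y - P.src e) + b • (z - P.src e) := by
        obtain rfl : b = 1 - a := by linarith
        module
      rw [this]
      simp
    rcases lt_trichotomy (φ (a • y + b • z - P.src e)) 0 with h0 | h0 | h0
    · by_cases hy0 : φ (y - P.src e) < 0
      · exact hneg y hy hy0 _ hb' h0
      by_cases hz0 : φ (z - P.src e) < 0
      · exact hneg z hz hz0 _ hb' h0
      nlinarith
    · exact P.edge_subset_carrier e (hzero _ hb' h0)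
    · by_cases hy0 : 0 < φ (y - P.src e)
      · exact hpos y hy hy0 _ hb' h0
      by_cases hz0 : 0 < φ (z - P.src e)
      · exact hpos z hz hz0 _ hb' h0
      nlinarith
  · intro y hy z hz a b ha hb hab
    refine ⟨subset_of_isPreconnected_of_disjoint_frontier (convex_ball x r).isPreconnected
      P.isClosed ?_ ⟨y, hy.2, hy.1⟩ (convex_ball x r hy.2 hz.2 ha hb hab),
      convex_ball x r hy.2 hz.2 ha hb hab⟩
    rw [disjoint_left]
    intro w hw hwf
    rw [P.frontier_eq_iUnion_edge] at hwf
    obtain ⟨f, hwf⟩ := mem_iUnion.1 hwf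
    exact hne ⟨f, h.mem_edge f w hwf hw⟩

end PolygonalRegion

/-! ### Lipschitz paths and existence of minimizers. -/

/-- There is a `1`-Lipschitz path in `X` from `x` at time `0` to `y` at time `T`. -/
def LipReach (X : Set Plane) (T : ℝ) (x y : Plane) : Prop :=
  0 ≤ T ∧ ∃ f : ℝ → Plane, LipschitzWith 1 f ∧ (∀ t, f t ∈ X) ∧ f 0 = x ∧ f T = y

/-- The path `f` is a `1`-Lipschitz path in `X` on `[0, T]` from `x` to `y`, and no such path
takes less time. -/
structure IsMinimizer (X : Set Plane) (x y : Plane) (T : ℝ) (f : ℝ → Plane) : Prop where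
  nonneg : 0 ≤ T
  lipschitz : LipschitzWith 1 f
  mem : ∀ t, f t ∈ X
  start : f 0 = x
  finish : f T = y
  le_of_reach : ∀ T', LipReach X T' x y → T ≤ T'

variable {X : Set Plane} {x y z : Plane} {T T₁ T₂ : ℝ} {f : ℝ → Plane}

lemma lipschitzWith_one_iff {f : ℝ → Plane} :
    LipschitzWith 1 f ↔ ∀ s t, s ≤ t → dist (f s) (f t) ≤ t - s := by
  simp only [lipschitzWith_iff_dist_le_mul, NNReal.coe_one, one_mul]
  refine ⟨fun h s t hst => (h s t).trans_eq ?_, fun h s t => ?_⟩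
  · rw [dist_comm, Real.dist_eq, abs_of_nonneg (sub_nonneg.2 hst)]
  · rcases le_total s t with hst | hst
    · rw [dist_comm s, Real.dist_eq, abs_of_nonneg (sub_nonneg.2 hst)]
      exact h s t hst
    · rw [dist_comm (f s), Real.dist_eq, abs_of_nonneg (sub_nonneg.2 hst)]
      exact h t s hst

lemma LipReach.of_segment_subset (h : segment ℝ x y ⊆ X) : LipReach X (dist x y) x y := by
  refine ⟨dist_nonneg, fun t => AffineMap.lineMap x y (projIcc (0 : ℝ) 1 zero_le_one
    (t / dist x y) : ℝ), ?_, fun t => h ?_, ?_, ?_⟩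
  · refine LipschitzWith.of_dist_le_mul fun s t => ?_
    rw [dist_lineMap_lineMap, NNReal.coe_one, one_mul]
    rcases eq_or_ne x y with rfl | hne
    · simp
    have hd := dist_pos.2 hne
    have := (LipschitzWith.projIcc (zero_le_one (α := ℝ))).dist_le_mul (s / dist x y) (t / dist x y)
    rw [NNReal.coe_one, one_mul, Subtype.dist_eq] at this
    refine (mul_le_mul_of_nonneg_right this hd.le).trans_eq ?_
    rw [Real.dist_eq, Real.dist_eq, ← sub_div, abs_div, abs_of_pos hd, div_mul_cancel₀ _ hd.ne']
  · rw [segment_eq_image_lineMap]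
    exact mem_image_of_mem _ (Subtype.coe_prop _)
  · simp
  · rcases eq_or_ne x y with rfl | hne
    · simp
    · simp [div_self (dist_pos.2 hne).ne']

lemma LipReach.trans (h₁ : LipReach X T₁ x y) (h₂ : LipReach X T₂ y z) :
    LipReach X (T₁ + T₂) x z := by
  obtain ⟨hT₁, f, hf, hfX, rfl, rfl⟩ := h₁
  obtain ⟨hT₂, g, hg, hgX, hg0, rfl⟩ := h₂
  refine ⟨add_nonneg hT₁ hT₂, fun t => if t ≤ T₁ then f t else g (t - T₁), ?_, fun t => ?_, ?_, ?_⟩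
  · rw [lipschitzWith_one_iff] at *
    intro s t hst
    rcases le_or_gt t T₁ with ht | ht
    · simpa [ht, hst.trans ht] using hf s t hst
    rcases le_or_gt s T₁ with hs | hs
    · simp only [hs, ht.not_ge, if_true, if_false]
      have h1 := hf s T₁ hs
      have h2 := hg 0 (t - T₁) (by linarith)
      have h3 := dist_triangle (f s) (f T₁) (g (t - T₁))
      rw [hg0] at h2
      linarith
    · simpa [hs.not_ge, ht.not_ge] using hg (s - T₁) (t - T₁) (by linarith)
  · dsimp only
    split_ifs
    exacts [hfX _, hgX _]
  · simp [hT₁]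
  · dsimp only
    split_ifs with h
    · obtain rfl : T₂ = 0 := by linarith
      simp [hg0]
    · simp

lemma LipReach.of_path (hf : LipschitzWith 1 f) (hfX : ∀ t, f t ∈ X) {s t : ℝ} (hst : s ≤ t) :
    LipReach X (t - s) (f s) (f t) := by
  refine ⟨sub_nonneg.2 hst, fun r => f (s + r), ?_, fun r => hfX _, by simp, by simp⟩
  rw [lipschitzWith_one_iff] at *
  intro a b hab
  simpa using hf (s + a) (s + b) (by linarith)

/-- Reachability is transitive and, by local star-shapedness, holds both ways between nearby points,
so connectedness spreads it. -/
lemma PolygonalRegion.exists_lipReach (P : PolygonalRegion) (hP : IsPreconnected P.carrier)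
    (hx : x ∈ P.carrier) (hy : y ∈ P.carrier) : ∃ T, LipReach P.carrier T x y := by
  refine hP.induction₂' (fun x y => ∃ T, LipReach P.carrier T x y) (fun x hx => ?_)
    (fun x y z _ _ _ ⟨T₁, h₁⟩ ⟨T₂, h₂⟩ => ⟨_, h₁.trans h₂⟩) hx hy
  obtain ⟨r, hr⟩ := P.exists_isIsolating x
  filter_upwards [self_mem_nhdsWithin, mem_nhdsWithin_of_mem_nhds (Metric.ball_mem_nhds x hr.pos)]
    with y hy hyb
  have := hr.segment_subset hx hy hyb
  exact ⟨⟨_, .of_segment_subset this⟩, ⟨_, .of_segment_subset (segment_symm ℝ x y ▸ this)⟩⟩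

/-- In a compact set, a minimal time for Lipschitz paths is attained. -/
lemma exists_isMinimizer (hX : IsCompact X) (h : ∃ T, LipReach X T x y) :
    ∃ T f, IsMinimizer X x y T f := by
  obtain ⟨T₀, hT₀, f₀, hf₀, hfX₀, hf₀0, hf₀T⟩ := h
  -- Evaluation `(T, f) ↦ f T` is not continuous for pointwise convergence. The last condition
  -- replaces `f T = y`: it is closed in `(T, f)` and gives back the equality at `t = T`.
  let C : Set (ℝ × (ℝ → Plane)) := {p | (∀ s t, dist (p.2 s) (p.2 t) ≤ dist s t) ∧ p.2 0 = x ∧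
    ∀ t, dist (p.2 t) y ≤ max (p.1 - t) 0}
  have hC : IsClosed C := by
    simp only [C, ofPred_and, ofPred_forall]
    refine (isClosed_iInter fun s => isClosed_iInter fun t => ?_).inter
      (IsClosed.inter ?_ (isClosed_iInter fun t => ?_))
    · exact isClosed_le (by fun_prop) (by fun_prop)
    · exact isClosed_eq (by fun_prop) (by fun_prop)
    · exact isClosed_le (by fun_prop) (by fun_prop)
  have hK : IsCompact ((Icc (0 : ℝ) T₀ ×ˢ univ.pi fun _ => X) ∩ C) :=
    (isCompact_Icc.prod (isCompact_univ_pi fun _ => hX)).inter_right hC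
  -- Paths are frozen outside `[0, T]` to satisfy that condition. The bound `min 0 T`, equal to `0`
  -- here, makes the interval nonempty for every `T`.
  have hmem : ∀ T f, LipschitzWith 1 f → (∀ t, f t ∈ X) → f 0 = x → f T = y → T ∈ Icc 0 T₀ →
      (T, fun t => f (projIcc (min 0 T) T (min_le_right _ _) t)) ∈
        (Icc (0 : ℝ) T₀ ×ˢ univ.pi fun _ => X) ∩ C := by
    intro T f hf hfX hf0 hfT hT
    have hf' : ∀ s t, dist (f s) (f t) ≤ dist s t := fun s t => by simpa using hf.dist_le_mul s t
    refine ⟨⟨hT, fun t _ => hfX _⟩, fun s t => (hf' _ _).trans ?_, ?_, fun t => ?_⟩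
    · simpa [Subtype.dist_eq] using (LipschitzWith.projIcc (min_le_right 0 T)).dist_le_mul s t
    · simp [coe_projIcc, hT.1, hf0]
    · have hp : ∃ u, u ≤ T ∧ T - u ≤ max (T - t) 0 ∧
          (projIcc (min 0 T) T (min_le_right _ _) t : ℝ) = u := by
        refine ⟨_, (projIcc (min 0 T) T (min_le_right _ _) t).2.2, ?_, rfl⟩
        rw [coe_projIcc]
        rcases le_total T t with h | h
        · simp [h, hT.1]
        · simp only [min_eq_left hT.1, min_eq_right h]
          exact le_max_of_le_left (sub_le_sub_left (le_max_right _ _) _)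
      obtain ⟨u, huT, hu, hpu⟩ := hp
      dsimp only
      rw [hpu]
      calc dist (f u) y ≤ dist u T := hfT ▸ hf' u T
        _ = T - u := by rw [dist_comm, Real.dist_eq, abs_of_nonneg (sub_nonneg.2 huT)]
        _ ≤ _ := hu
  obtain ⟨⟨T, f⟩, ⟨⟨hT, hfX⟩, hfL, hf0, hfT⟩, hmin⟩ := hK.exists_isMinOn
    ⟨_, hmem T₀ f₀ hf₀ hfX₀ hf₀0 hf₀T ⟨hT₀, le_rfl⟩⟩ continuous_fst.continuousOn
  refine ⟨T, f, hT.1, LipschitzWith.of_dist_le_mul fun s t => by simpa using hfL s t,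
    fun t => hfX t trivial, hf0, ?_, ?_⟩
  · simpa using hfT T
  · rintro T' ⟨hT', g, hg, hgX, hg0, hgT⟩
    rcases le_total T' T₀ with h | h
    · exact hmin (hmem T' g hg hgX hg0 hgT ⟨hT', h⟩)
    · exact hT.2.trans h

/-! ### Straightness of minimizers. -/

namespace IsMinimizer

/-- Cut and paste: splicing a faster link between `f s` and `f t` would shorten the whole trip. -/
lemma sub_le_of_reach (hf : IsMinimizer X x y T f) {s t τ : ℝ} (hs : 0 ≤ s) (ht : t ≤ T)
    (h : LipReach X τ (f s) (f t)) : t - s ≤ τ := by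
  have h₁ := LipReach.of_path hf.lipschitz hf.mem hs
  have h₂ := LipReach.of_path hf.lipschitz hf.mem ht
  have := hf.le_of_reach _ (hf.start ▸ hf.finish ▸ (h₁.trans h).trans h₂)
  linarith

lemma dist_eq_of_segment_subset (hf : IsMinimizer X x y T f) {s t : ℝ} (hs : 0 ≤ s)
    (hst : s ≤ t) (ht : t ≤ T) (h : segment ℝ (f s) (f t) ⊆ X) : dist (f s) (f t) = t - s :=
  le_antisymm (lipschitzWith_one_iff.1 hf.lipschitz s t hst)
    (hf.sub_le_of_reach hs ht (.of_segment_subset h))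

lemma injOn (hf : IsMinimizer X x y T f) : InjOn f (Icc 0 T) := by
  have key : ∀ s ∈ Icc 0 T, ∀ t ∈ Icc 0 T, f s = f t → t ≤ s := by
    intro s hs t ht hst
    have : LipReach X 0 (f s) (f t) := by
      simpa [hst] using LipReach.of_path hf.lipschitz hf.mem (le_refl t)
    linarith [hf.sub_le_of_reach hs.1 ht.2 this]
  exact fun s hs t ht h => le_antisymm (key t ht s hs h.symm) (key s hs t ht h)

end IsMinimizer

/-- A path which locally moves at unit speed along segments moves along one segment. -/
lemma exists_eq_add_smul {a b : ℝ} (hab : a < b) (hf : ContinuousOn f (Icc a b))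
    (hloc : ∀ t ∈ Ioo a b, ∀ᶠ p in 𝓝 t ×ˢ 𝓝 t, p.1 ≤ p.2 → dist (f p.1) (f p.2) = p.2 - p.1) :
    ∃ w : Plane, ‖w‖ = 1 ∧ ∀ t ∈ Icc a b, f t = f a + (t - a) • w := by
  have haff : ∀ t ∈ Ioo a b, ∃ w : Plane, ‖w‖ = 1 ∧ ∀ᶠ s in 𝓝 t, f s = f t + (s - t) • w := by
    intro t ht
    have hev := hloc t ht
    rw [← nhds_prod_eq, Metric.eventually_nhds_iff] at hev
    obtain ⟨ε, hε, hev⟩ := hev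
    replace hev : ∀ u v, |u - t| < ε → |v - t| < ε → u ≤ v → dist (f u) (f v) = v - u :=
      fun u v hu hv => hev (y := (u, v)) (by
        rw [Prod.dist_eq, Real.dist_eq, Real.dist_eq]
        exact max_lt hu hv)
    set c := t - ε / 2
    set d := t + ε / 2
    have hcd : 0 < d - c := by simp only [c, d]; linarith
    have hc : |c - t| < ε := by rw [abs_lt]; constructor <;> simp only [c] <;> linarith
    have hd : |d - t| < ε := by rw [abs_lt]; constructor <;> simp only [d] <;> linarith
    have hlen := hev c d hc hd (by linarith)
    -- Equality in the triangle inequality puts `f s` on the segment, by strict convexity of the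
    -- Euclidean norm.
    have hmid : ∀ s ∈ Icc c d, f s = f c + (s - c) • ((d - c)⁻¹ • (f d - f c)) := by
      intro s hs
      have hs' : |s - t| < ε := by
        rw [abs_lt]; constructor <;> linarith [(abs_lt.1 hc).1, (abs_lt.1 hd).2, hs.1, hs.2]
      have := eq_lineMap_of_dist_eq_mul_of_dist_eq_mul (x := f c) (y := f s) (z := f d)
        (r := (s - c) / (d - c)) (by rw [hev c s hc hs' hs.1, hlen]; field_simp)
        (by rw [hev s d hs' hd hs.2, hlen]; field_simp; ring)
      rw [this, AffineMap.lineMap_apply_module', smul_smul, div_eq_mul_inv, add_comm]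
    refine ⟨(d - c)⁻¹ • (f d - f c), ?_, ?_⟩
    · rw [norm_smul, ← dist_eq_norm, dist_comm, hlen, norm_inv, Real.norm_of_nonneg hcd.le,
        inv_mul_cancel₀ hcd.ne']
    · filter_upwards [Icc_mem_nhds (show c < t by simp only [c]; linarith)
        (show t < d by simp only [d]; linarith)] with s hs
      rw [hmid s hs, hmid t ⟨by simp only [c]; linarith, by simp only [d]; linarith⟩, add_assoc,
        ← add_smul]
      congr 2
      ring
  have hder : ∀ t ∈ Ioo a b, ‖deriv f t‖ = 1 ∧ ∀ᶠ s in 𝓝 t, deriv f s = deriv f t ∧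
      f s = f t + (s - t) • deriv f t := by
    intro t ht
    obtain ⟨w, hw, hwt⟩ := haff t ht
    have hd : ∀ᶠ s in 𝓝 t, deriv f s = w := by
      filter_upwards [hwt.eventually_nhds] with s hs
      rw [EventuallyEq.deriv_eq hs]
      simpa using ((((hasDerivAt_id s).sub_const t).smul_const w).const_add (f t)).deriv
    have hdt := hd.self_of_nhds
    refine ⟨hdt ▸ hw, ?_⟩
    filter_upwards [hd, hwt] with s hs hs'
    rw [hdt]
    exact ⟨hs, hs'⟩
  -- The velocity is locally constant, hence constant on the connected open interval; continuity
  -- later adds the endpoints.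
  have hglob : ∀ s ∈ Ioo a b, ∀ t ∈ Ioo a b, deriv f t = deriv f s ∧
      f t = f s + (t - s) • deriv f s := by
    intro s hs t ht
    refine isPreconnected_Ioo.induction₂' (fun s t => deriv f t = deriv f s ∧
      f t = f s + (t - s) • deriv f s) (fun u hu => ?_) ?_ hs ht
    · filter_upwards [mem_nhdsWithin_of_mem_nhds (hder u hu).2] with v hv
      refine ⟨hv, hv.1.symm, ?_⟩
      rw [hv.1, hv.2]
      module
    · rintro u v w - - - ⟨h1, h2⟩ ⟨h3, h4⟩
      refine ⟨h3.trans h1, ?_⟩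
      rw [h4, h2, h1]
      module
  have hm : (a + b) / 2 ∈ Ioo a b := ⟨by linarith, by linarith⟩
  set m := (a + b) / 2
  have hcl : EqOn f (fun t => f m + (t - m) • deriv f m) (Icc a b) := by
    rw [← closure_Ioo hab.ne] at hf ⊢
    exact EqOn.of_subset_closure (fun t ht => (hglob m hm t ht).2) hf (by fun_prop) subset_closure
      subset_rfl
  refine ⟨deriv f m, (hder m hm).1, fun t ht => ?_⟩
  rw [hcl ht, hcl (left_mem_Icc.2 hab.le)]
  module

/-- Between vertices, a time-minimal path runs along a segment at unit speed. -/
lemma IsMinimizer.exists_eq_add_smul {P : PolygonalRegion} (hf : IsMinimizer P.carrier x y T f)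
    {a b : ℝ} (ha : 0 ≤ a) (hab : a < b) (hb : b ≤ T) (hv : ∀ t ∈ Ioo a b, f t ∉ P.vertices) :
    ∃ w : Plane, ‖w‖ = 1 ∧ ∀ t ∈ Icc a b, f t = f a + (t - a) • w := by
  refine PolyNav.exists_eq_add_smul hab hf.lipschitz.continuous.continuousOn fun t ht => ?_
  obtain ⟨r, hr⟩ := P.exists_isIsolating (f t)
  have hev : ∀ᶠ s in 𝓝 t, s ∈ Ioo a b ∧ f s ∈ Metric.ball (f t) r :=
    (eventually_mem_set.2 (Ioo_mem_nhds ht.1 ht.2)).and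
      (hf.lipschitz.continuous.continuousAt (Metric.ball_mem_nhds _ hr.pos))
  filter_upwards [hev.prod_mk hev] with p hp hle
  refine hf.dist_eq_of_segment_subset (ha.trans hp.1.1.1.le) hle (hp.2.1.2.le.trans hb) ?_
  exact ((hr.convex_inter (hv t ht)).segment_subset ⟨hf.mem _, hp.1.2⟩ ⟨hf.mem _, hp.2.2⟩).trans
    inter_subset_left

/-! ### Passage between paths and controls. -/

lemma continuous_velocity : Continuous velocity := by
  refine (PiLp.continuous_toLp 2 _).comp (continuous_pi fun i => ?_)
  fin_cases i
  · exact Real.Angle.continuous_sin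
  · exact Real.Angle.continuous_cos

lemma norm_velocity (θ : Real.Angle) : ‖velocity θ‖ = 1 := by
  rw [EuclideanSpace.norm_eq, Real.sqrt_eq_one]
  simp [velocity, Fin.sum_univ_two, add_comm (θ.sin ^ 2)]

lemma velocity_injective : Function.Injective velocity := by
  intro θ ψ h
  have h0 : θ.sin = ψ.sin := congrArg (fun p : Plane => p 0) h
  have h1 : θ.cos = ψ.cos := congrArg (fun p : Plane => p 1) h
  induction θ using Real.Angle.induction_on
  induction ψ using Real.Angle.induction_on
  exact Real.Angle.cos_sin_inj h1 h0

/-- The control value producing the direction of a vector. -/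
noncomputable def heading (w : Plane) : Real.Angle := (Complex.arg ⟨w 1, w 0⟩ : ℝ)

lemma velocity_heading {w : Plane} (hw : ‖w‖ = 1) : velocity (heading w) = w := by
  have hn : ‖(⟨w 1, w 0⟩ : ℂ)‖ = 1 := by
    rw [EuclideanSpace.norm_eq, Real.sqrt_eq_one] at hw
    rw [← sq_eq_sq₀ (norm_nonneg _) zero_le_one, Complex.sq_norm, Complex.normSq_mk, one_pow, ← hw]
    simp [Fin.sum_univ_two]
    ring
  have h0 : (⟨w 1, w 0⟩ : ℂ) ≠ 0 := norm_ne_zero_iff.1 (by rw [hn]; exact one_ne_zero)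
  ext i
  fin_cases i
  · simp [velocity, heading, Complex.sin_arg, hn]
  · simp [velocity, heading, Complex.cos_arg h0, hn]

/-- The argument is measurable but not continuous, so it is treated as a real-valued function and
then sent to `Real.Angle` by the continuous coercion. -/
lemma aestronglyMeasurable_heading_deriv (f : ℝ → Plane) (μ : Measure ℝ) :
    AEStronglyMeasurable (fun t => heading (deriv f t)) μ := by
  refine Real.Angle.continuous_coe.comp_aestronglyMeasurable
    (Measurable.aestronglyMeasurable (Complex.measurable_arg.comp ?_))
  have hd : Measurable (deriv f) := measurable_deriv f
  have hc : Continuous fun w : Plane => (⟨w 1, w 0⟩ : ℂ) :=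
    Complex.equivRealProdCLM.symm.continuous.comp
      (g := fun p : ℝ × ℝ => (⟨p.1, p.2⟩ : ℂ)) (f := fun w : Plane => (w 1, w 0)) (by fun_prop)
  exact hc.measurable.comp hd

variable {P : PolygonalRegion} {θ : ℝ → Real.Angle}

lemma intervalIntegrable_velocity
    (hθ : AEStronglyMeasurable θ (volume.restrict (Icc 0 T))) {s t : ℝ}
    (hs : s ∈ Icc 0 T) (ht : t ∈ Icc 0 T) :
    IntervalIntegrable (fun r => velocity (θ r)) volume s t := by
  have : IntegrableOn (fun r => velocity (θ r)) (Icc 0 T) := by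
    refine Integrable.of_bound (continuous_velocity.comp_aestronglyMeasurable hθ) 1 ?_
    exact Eventually.of_forall fun r => (norm_velocity _).le
  rw [intervalIntegrable_iff]
  exact this.mono_set (uIoc_subset_uIcc.trans (uIcc_subset_Icc hs ht))

lemma state_sub_state (hθ : AEStronglyMeasurable θ (volume.restrict (Icc 0 T))) {s t : ℝ}
    (hs : s ∈ Icc 0 T) (ht : t ∈ Icc 0 T) :
    state x θ t - state x θ s = ∫ r in s..t, velocity (θ r) := by
  have h0 : (0 : ℝ) ∈ Icc 0 T := ⟨le_rfl, hs.1.trans hs.2⟩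
  rw [state, state, add_sub_add_left_eq_sub, intervalIntegral.integral_interval_sub_left
    (intervalIntegrable_velocity hθ h0 ht) (intervalIntegrable_velocity hθ h0 hs)]

lemma state_zero : state x θ 0 = x := by simp [state]

lemma dist_state_le (hθ : AEStronglyMeasurable θ (volume.restrict (Icc 0 T))) {s t : ℝ}
    (hs : s ∈ Icc 0 T) (ht : t ∈ Icc 0 T) : dist (state x θ s) (state x θ t) ≤ dist s t := by
  rw [dist_comm, dist_eq_norm, state_sub_state hθ hs ht, dist_comm s, Real.dist_eq, ← one_mul |_|]
  exact intervalIntegral.norm_integral_le_of_norm_le_const fun r _ => (norm_velocity _).le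

/-- The path of an admissible control, extended to be constant outside `[0, T]`. -/
noncomputable def extendedState (x : Plane) (T : ℝ) (hT : 0 ≤ T) (θ : ℝ → Real.Angle) (t : ℝ) :
    Plane :=
  state x θ (projIcc 0 T hT t)

lemma extendedState_of_mem (hT : 0 ≤ T) {t : ℝ} (ht : t ∈ Icc 0 T) :
    extendedState x T hT θ t = state x θ t := by
  rw [extendedState, projIcc_of_mem hT ht]

lemma IsAdmissible.lipschitzWith (h : IsAdmissible P x y T θ) :
    LipschitzWith 1 (extendedState x T h.nonneg θ) := by
  refine LipschitzWith.of_dist_le_mul fun s t => ?_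
  refine (dist_state_le h.measurable (Subtype.coe_prop _) (Subtype.coe_prop _)).trans ?_
  simpa [Subtype.dist_eq] using (LipschitzWith.projIcc h.nonneg).dist_le_mul s t

lemma IsAdmissible.extendedState_mem (h : IsAdmissible P x y T θ) (t : ℝ) :
    extendedState x T h.nonneg θ t ∈ P.carrier :=
  h.state_mem _ (Subtype.coe_prop _)

lemma IsAdmissible.extendedState_zero (h : IsAdmissible P x y T θ) :
    extendedState x T h.nonneg θ 0 = x := by
  rw [extendedState_of_mem h.nonneg ⟨le_rfl, h.nonneg⟩, state_zero]

lemma IsAdmissible.extendedState_final (h : IsAdmissible P x y T θ) :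
    extendedState x T h.nonneg θ T = y := by
  rw [extendedState_of_mem h.nonneg ⟨h.nonneg, le_rfl⟩, h.final]

lemma IsAdmissible.lipReach (h : IsAdmissible P x y T θ) : LipReach P.carrier T x y :=
  ⟨h.nonneg, _, h.lipschitzWith, h.extendedState_mem, h.extendedState_zero, h.extendedState_final⟩

lemma IsMinimizer.finite_preimage_vertices (hf : IsMinimizer P.carrier x y T f) :
    (Icc 0 T ∩ f ⁻¹' P.vertices).Finite :=
  Set.Finite.of_finite_image
    (P.finite_vertices.subset (image_subset_iff.2 inter_subset_right))
    (hf.injOn.mono inter_subset_left)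

/-- A time-minimal path has a derivative of norm one away from the vertices. -/
lemma IsMinimizer.hasDerivAt (hf : IsMinimizer P.carrier x y T f) {t : ℝ} (ht : t ∈ Ioo 0 T)
    (hv : f t ∉ P.vertices) : HasDerivAt f (velocity (heading (deriv f t))) t := by
  have hev : ∀ᶠ s in 𝓝 t, s ∈ Ioo 0 T ∧ f s ∉ P.vertices :=
    (eventually_mem_set.2 (Ioo_mem_nhds ht.1 ht.2)).and
      (hf.lipschitz.continuous.continuousAt
        (P.finite_vertices.isClosed.isOpen_compl.mem_nhds hv))
  obtain ⟨ε, hε, hball⟩ := Metric.eventually_nhds_iff.1 hev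
  have hmem : ∀ s ∈ Icc (t - ε / 2) (t + ε / 2), s ∈ Ioo 0 T ∧ f s ∉ P.vertices := fun s hs =>
    hball (by rw [Real.dist_eq, abs_lt]; constructor <;> linarith [hs.1, hs.2])
  obtain ⟨w, hw, hfw⟩ := hf.exists_eq_add_smul (a := t - ε / 2) (b := t + ε / 2)
    (hmem _ ⟨le_rfl, by linarith⟩).1.1.le (by linarith) (hmem _ ⟨by linarith, le_rfl⟩).1.2.le
    (fun s hs => (hmem s (Ioo_subset_Icc_self hs)).2)
  have hd : HasDerivAt f w t := by
    have h1 := (((hasDerivAt_id t).sub_const (t - ε / 2)).smul_const w).const_add (f (t - ε / 2))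
    rw [one_smul] at h1
    refine h1.congr_of_eventuallyEq ?_
    filter_upwards [Icc_mem_nhds (show t - ε / 2 < t by linarith) (show t < t + ε / 2 by linarith)]
      with s hs using hfw s hs
  rwa [hd.deriv, velocity_heading hw]

/-- Vertices are met at finitely many times only, and the fundamental theorem of calculus tolerates
a countable exceptional set, so integrating the control recovers `f`. -/
lemma IsMinimizer.isAdmissible (hf : IsMinimizer P.carrier x y T f) :
    IsAdmissible P x y T fun t => heading (deriv f t) := by
  have hmeas := aestronglyMeasurable_heading_deriv f (volume.restrict (Icc 0 T))
  have hstate : ∀ t ∈ Icc 0 T, state x (fun t => heading (deriv f t)) t = f t := by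
    intro t ht
    rw [state, integral_eq_of_hasDerivAt_off_countable_of_le f _ ht.1
      hf.finite_preimage_vertices.countable hf.lipschitz.continuous.continuousOn ?_
      (intervalIntegrable_velocity hmeas ⟨le_rfl, hf.nonneg⟩ ht), hf.start, add_sub_cancel]
    rintro s ⟨hs, hsv⟩
    have hs' : s ∈ Ioo 0 T := ⟨hs.1, hs.2.trans_le ht.2⟩
    exact hf.hasDerivAt hs' fun h => hsv ⟨Ioo_subset_Icc_self hs', h⟩
  exact ⟨hf.nonneg, hmeas, fun t ht => hstate t ht ▸ hf.mem t,
    (hstate T ⟨hf.nonneg, le_rfl⟩).trans hf.finish⟩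

lemma IsMinimizer.isOptimal (hf : IsMinimizer P.carrier x y T f) :
    IsOptimal P x y T fun t => heading (deriv f t) :=
  ⟨hf.isAdmissible, fun _ _ h => hf.le_of_reach _ h.lipReach⟩

/-- Lipschitz competitors may move slower than unit speed and come from no control. Comparison goes
through a minimizer, which does come from one. -/
lemma IsOptimal.isMinimizer (h : IsOptimal P x y T θ) :
    IsMinimizer P.carrier x y T (extendedState x T h.1.nonneg θ) where
  nonneg := h.1.nonneg
  lipschitz := h.1.lipschitzWith
  mem := h.1.extendedState_mem
  start := h.1.extendedState_zero
  finish := h.1.extendedState_final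
  le_of_reach T' hT' := by
    obtain ⟨T₁, f₁, h₁⟩ := exists_isMinimizer P.isCompact ⟨T', hT'⟩
    exact (h.2 _ _ h₁.isAdmissible).trans (h₁.le_of_reach _ hT')

/-- A control producing a rectilinear motion at unit speed is almost everywhere constant. -/
lemma ae_eq_of_state_eq (hθ : AEStronglyMeasurable θ (volume.restrict (Icc 0 T))) {a b : ℝ}
    (ha : 0 ≤ a) (hab : a ≤ b) (hb : b ≤ T) {ψ : Real.Angle}
    (h : state x θ b = state x θ a + (b - a) • velocity ψ) :
    ∀ᵐ s ∂(volume.restrict (Icc a b)), θ s = ψ := by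
  have ha' : a ∈ Icc 0 T := ⟨ha, hab.trans hb⟩
  have hb' : b ∈ Icc 0 T := ⟨ha.trans hab, hb⟩
  have hi : IntervalIntegrable (fun r => velocity (θ r)) volume a b :=
    intervalIntegrable_velocity hθ ha' hb'
  have hint : ∫ r in a..b, velocity (θ r) = (b - a) • velocity ψ := by
    rw [← state_sub_state hθ ha' hb', h, add_sub_cancel_left]
  -- The speed along `velocity ψ` is at most `1` and averages `1`, so it equals `1` a.e.; for unit
  -- vectors this forces equality.
  have hinner : ∫ r in a..b, inner ℝ (velocity ψ) (velocity (θ r)) = b - a := by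
    have := ContinuousLinearMap.intervalIntegral_comp_comm (innerSL ℝ (velocity ψ)) hi
    simp only [innerSL_apply_apply] at this
    rw [this, hint, inner_smul_right, real_inner_self_eq_norm_sq, norm_velocity]
    ring
  have hii : IntervalIntegrable (fun r => inner ℝ (velocity ψ) (velocity (θ r))) volume a b :=
    ⟨(innerSL ℝ (velocity ψ)).integrable_comp hi.1, (innerSL ℝ (velocity ψ)).integrable_comp hi.2⟩
  have hzero : ∫ r in a..b, (1 - inner ℝ (velocity ψ) (velocity (θ r))) = 0 := by
    rw [intervalIntegral.integral_sub intervalIntegrable_const hii, hinner]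
    simp
  rw [intervalIntegral.integral_of_le hab, integral_eq_zero_iff_of_nonneg] at hzero
  · rw [Measure.restrict_congr_set Ioc_ae_eq_Icc.symm]
    filter_upwards [hzero] with s hs
    refine velocity_injective ((inner_eq_one_iff_of_norm_eq_one (𝕜 := ℝ) (norm_velocity _)
      (norm_velocity _)).1 ?_).symm
    exact (sub_eq_zero.1 hs).symm
  · intro r
    have := real_inner_le_norm (velocity ψ) (velocity (θ r))
    rw [norm_velocity, norm_velocity, one_mul] at this
    exact sub_nonneg.2 this
  · exact (intervalIntegrable_const.sub hii).1

/-! ### Splitting an optimal control into actions. -/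

lemma exists_consecutive_enumeration {S : Finset ℝ} {a b : ℝ} (ha : a ∈ S) (hb : b ∈ S)
    (hS : ∀ s ∈ S, s ∈ Icc a b) :
    ∃ (N : ℕ) (t : Fin (N + 1) → ℝ), t 0 = a ∧ t (Fin.last N) = b ∧ (∀ i, t i ∈ S) ∧
      ∀ i : Fin N, t i.castSucc < t i.succ ∧ ∀ s ∈ Ioo (t i.castSucc) (t i.succ), s ∉ S := by
  have hcard : S.card = S.card - 1 + 1 := (Nat.sub_add_cancel (Finset.card_pos.2 ⟨a, ha⟩)).symm
  let t := S.orderEmbOfFin hcard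
  have hsurj : ∀ s ∈ S, ∃ i, t i = s := fun s hs => by
    rw [← mem_range, Finset.range_orderEmbOfFin]
    exact hs
  have hmem : ∀ i, t i ∈ S := S.orderEmbOfFin_mem hcard
  refine ⟨S.card - 1, t, ?_, ?_, hmem, fun i => ⟨t.strictMono i.castSucc_lt_succ, ?_⟩⟩
  · obtain ⟨i, hi⟩ := hsurj a ha
    exact le_antisymm (hi ▸ t.monotone (Fin.zero_le i)) (hS _ (hmem _)).1
  · obtain ⟨i, hi⟩ := hsurj b hb
    exact le_antisymm (hS _ (hmem _)).2 (hi ▸ t.monotone (Fin.le_last i))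
  · intro s hs hsS
    obtain ⟨j, rfl⟩ := hsurj s hsS
    have h1 := t.lt_iff_lt.1 hs.1
    have h2 := t.lt_iff_lt.1 hs.2
    rw [Fin.lt_def] at h1 h2
    simp at h1 h2
    omega

theorem IsOptimal.exists_isObtainedBy (hy : y ∈ P.vertices) (h : IsOptimal P x y T θ) :
    ∃ (N : ℕ) (u : Fin N → Action P), IsObtainedBy x T θ u := by
  have hT := h.1.nonneg
  have hf := h.isMinimizer
  set f := extendedState x T hT θ
  have hfs : ∀ t ∈ Icc 0 T, f t = state x θ t := fun t ht => extendedState_of_mem hT ht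
  -- The start need not be a vertex, so `0` is added; it is never the end of a step. If `T = 0` then
  -- `S = {0}` and there are no actions.
  let S : Finset ℝ := insert 0 (insert T hf.finite_preimage_vertices.toFinset)
  have hS : ∀ s, s ∈ S ↔ s = 0 ∨ s = T ∨ (s ∈ Icc 0 T ∧ f s ∈ P.vertices) := by simp [S]
  have hSIcc : ∀ s ∈ S, s ∈ Icc 0 T := by
    intro s hs
    rcases (hS s).1 hs with rfl | rfl | hs
    exacts [⟨le_rfl, hT⟩, ⟨hT, le_rfl⟩, hs.1]
  obtain ⟨N, t, ht0, htN, htS, hcons⟩ := exists_consecutive_enumeration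
    ((hS 0).2 (Or.inl rfl)) ((hS T).2 (Or.inr (Or.inl rfl))) hSIcc
  have hst : ∀ i, f (t i) = state x θ (t i) := fun i => hfs _ (hSIcc _ (htS i))
  have hvert : ∀ i : Fin N, state x θ (t i.succ) ∈ P.vertices := by
    intro i
    rw [← hst]
    rcases (hS _).1 (htS i.succ) with h0 | h0 | h0
    · have := (hcons i).1.trans_le h0.le
      exact absurd (hSIcc _ (htS i.castSucc)).1 this.not_ge
    · rw [h0, hf.finish]
      exact hy
    · exact h0.2
  have hnv : ∀ i : Fin N, ∀ s ∈ Ioo (t i.castSucc) (t i.succ), f s ∉ P.vertices := by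
    intro i s hs hsv
    refine (hcons i).2 s hs ((hS s).2 (Or.inr (Or.inr ⟨⟨?_, ?_⟩, hsv⟩)))
    · exact (hSIcc _ (htS i.castSucc)).1.trans hs.1.le
    · exact hs.2.le.trans (hSIcc _ (htS i.succ)).2
  have hw : ∀ i : Fin N, ∃ ψ : Real.Angle, ∀ s ∈ Icc (t i.castSucc) (t i.succ),
      f s = f (t i.castSucc) + (s - t i.castSucc) • velocity ψ := by
    intro i
    obtain ⟨w, hw, hfw⟩ := hf.exists_eq_add_smul (hSIcc _ (htS i.castSucc)).1 (hcons i).1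
      (hSIcc _ (htS i.succ)).2 (hnv i)
    exact ⟨heading w, by rwa [velocity_heading hw]⟩
  choose ψ hψ using hw
  refine ⟨N, fun i => ⟨ψ i, state x θ (t i.succ), hvert i⟩, t, ht0, htN, fun i => ?_⟩
  have hend : state x θ (t i.succ) =
      state x θ (t i.castSucc) + (t i.succ - t i.castSucc) • velocity (ψ i) := by
    rw [← hst, ← hst, hψ i _ ⟨(hcons i).1.le, le_rfl⟩]
  have hmid : ∀ s ∈ Icc 0 (t i.succ - t i.castSucc),
      state x θ (t i.castSucc) + s • velocity (ψ i) = f (t i.castSucc + s) := by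
    intro s hs
    rw [hψ i (t i.castSucc + s) ⟨by linarith [hs.1], by linarith [hs.2]⟩, hst, add_sub_cancel_left]
  refine ⟨⟨sub_pos.2 (hcons i).1, hend.symm, fun s hs => ?_, fun s hs => ?_⟩,
    ae_eq_of_state_eq h.1.measurable (hSIcc _ (htS i.castSucc)).1 (hcons i).1.le
      (hSIcc _ (htS i.succ)).2 hend⟩
  · dsimp only
    rw [hmid s hs]
    exact hf.mem _
  · dsimp only
    rw [hmid s (Ioo_subset_Icc_self hs)]
    exact hnv i _ ⟨by linarith [hs.1], by linarith [hs.2]⟩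

end PolyNav

theorem mainTheorem9 (P : PolyNav.PolygonalRegion) (hP : IsConnected P.carrier)
    (xI xG : PolyNav.Plane) (hI : xI ∈ P.carrier) (hG : xG ∈ P.vertices) :
    (∃ (T : ℝ) (θ : ℝ → Real.Angle), PolyNav.IsOptimal P xI xG T θ) ∧
    ∀ (T : ℝ) (θ : ℝ → Real.Angle), PolyNav.IsOptimal P xI xG T θ →
      ∃ (N : ℕ) (u : Fin N → PolyNav.Action P), PolyNav.IsObtainedBy xI T θ u := by
  refine ⟨?_, fun T θ h => h.exists_isObtainedBy hG⟩
  obtain ⟨T, f, hf⟩ := PolyNav.exists_isMinimizer P.isCompact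
    (P.exists_lipReach hP.isPreconnected hI (P.vertices_subset_carrier hG))
  exact ⟨T, _, hf.isOptimal⟩
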